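/- Let $K$ be a field with $|K|=2$, let $V$ be a finite-dimensional $K$-vector space and let $f:V\to V$ be a nilpotent $K$-linear map. A subspace $X\subseteq V$ is called hyperinvariant if it is invariant under all endomorphisms of $V$ that commute with $f$, and characteristic if it is $f$-invariant and invariant under the group $\mathrm{Aut}(V,f)$ of all automorphisms of $V$ that commute with $f$. For $x\in V$ put $\langle x\rangle=\mathrm{span}\{f^ix: i\ge 0\}$, let $\mathrm{e}(x)$ be the smallest integer $\ell\ge 0$ with $f^\ell x=0$, and let $\langle x\rangle^c=\sum_{\alpha\in\mathrm{Aut}(V,f)}\langle\alpha x\rangle$ be the characteristic hull of $x$. An elementary divisor $\lambda^r$ of $f$ is called unrepeated if it has multiplicity exactly one. Suppose that $f$ has exactly two unrepeated elementary divisors $\lambda^R$ and $\lambda^S$, where $R<S$ (other elementary divisors, if any, are repeated). Let $U=(u_1,\dots,u_m)$ be a generator tuple of $V$, that is, a tuple of nonzero vectors with $V=\langle u_1\rangle\oplus\cdots\oplus\langle u_m\rangle$ and $\mathrm{e}(u_1)\le\cdots\le\mathrm{e}(u_m)$; put $t_i=\mathrm{e}(u_i)$ and let $\rho,\tau$ be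 the indices with $t_\rho=R$ and $t_\tau=S$. Let $\mathcal L(\vec t\,)$ be the set of all $\vec r\in\mathbb Z^m$ with $0\le r_1\le\cdots\le r_m$ and $0\le t_1-r_1\le\cdots\le t_m-r_m$, and let $\vec e_1,\dots,\vec e_m$ be the standard unit vectors of $\mathbb Z^m$. Then a subspace $X\subseteq V$ is characteristic and not hyperinvariant if and only if there is a tuple $\vec\mu=(\mu_1,\dots,\mu_m)$ of nonnegative integers such that $$X=\langle f^{\mu_1}u_1+\cdots+f^{\mu_m}u_m\rangle^c,\qquad 0\le\mu_\rho<\mu_\tau,\qquad 0<R-\mu_\rho<S-\mu_\tau,\qquad \vec\mu+\vec e_\rho+\vec e_\tau\in\mathcal L(\vec t\,).$$ -/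

import Mathlib

namespace CharHyper

section

variable {K V : Type*} [Field K] [AddCommGroup V] [Module K V]

/-- A subspace is hyperinvariant under `f` if it is invariant under all endomorphisms of `V`
that commute with `f`. -/
def IsHyperinvariant (f : Module.End K V) (X : Submodule K V) : Prop :=
  ∀ g : Module.End K V, Commute g f → ∀ x ∈ X, g x ∈ X

/-- `Aut(V, f)`, the set of automorphisms of `V` that commute with `f`. -/
def commAut (f : Module.End K V) : Set (V ≃ₗ[K] V) :=
  {α | ∀ x, α (f x) = f (α x)}

/-- A subspace is characteristic with respect to `f` if it is `f`-invariant and invariant under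
all automorphisms of `V` that commute with `f`. -/
def IsCharacteristic (f : Module.End K V) (X : Submodule K V) : Prop :=
  (∀ x ∈ X, f x ∈ X) ∧ ∀ α ∈ commAut f, ∀ x ∈ X, α x ∈ X

/-- The `f`-cyclic subspace `⟨x⟩ = span {f ^ i x : i ≥ 0}`. -/
def cyclicSpan (f : Module.End K V) (x : V) : Submodule K V :=
  Submodule.span K (Set.range fun i : ℕ => (f ^ i) x)

/-- `⟨B⟩`, the sum of the `f`-cyclic subspaces `⟨b⟩`, `b ∈ B`. -/
def invSpan (f : Module.End K V) (B : Set V) : Submodule K V :=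
  ⨆ b ∈ B, cyclicSpan f b

/-- The characteristic hull `B ^ c = ⟨α b : b ∈ B, α ∈ Aut(V, f)⟩`. -/
def charHull (f : Module.End K V) (B : Set V) : Submodule K V :=
  invSpan f {y | ∃ α ∈ commAut f, ∃ b ∈ B, y = α b}

/-- The exponent `e(x)`: the smallest `ℓ ≥ 0` with `f ^ ℓ x = 0`
(used only for nilpotent `f`, where such `ℓ` exist). -/
noncomputable def exponent (f : Module.End K V) (x : V) : ℕ :=
  sInf {l : ℕ | (f ^ l) x = 0}

/-- For nilpotent `f` and `r ≥ 1`, the number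
`d(f, r) = dim ((ker f ∩ f ^ (r - 1) V) / (ker f ∩ f ^ r V))`, which is the multiplicity of
`λ ^ r` among the elementary divisors of `f`. For `r = 0` this formula gives `0`, which is again
that multiplicity. -/
noncomputable def elemDivMult (f : Module.End K V) (r : ℕ) : ℕ :=
  Module.finrank K
    (↥(LinearMap.ker f ⊓ LinearMap.range (f ^ (r - 1))) ⧸
      (LinearMap.ker f ⊓ LinearMap.range (f ^ r)).submoduleOf
        (LinearMap.ker f ⊓ LinearMap.range (f ^ (r - 1))))

/-- `λ ^ r` is an unrepeated elementary divisor of `f`. -/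
def IsUnrepeatedElemDiv (f : Module.End K V) (r : ℕ) : Prop :=
  elemDivMult f r = 1

/-- Generator tuple: `V` is the direct sum of the nonzero cyclic subspaces `⟨u i⟩`, and the
exponents are nondecreasing. (For nilpotent `f` the `λ ^ e(u i)` are then the elementary
divisors of `f`.) -/
structure IsGeneratorTuple (f : Module.End K V) {m : ℕ} (u : Fin m → V) : Prop where
  ne_zero : ∀ i, u i ≠ 0
  isInternal : DirectSum.IsInternal fun i => cyclicSpan f (u i)
  monotone_exponent : Monotone fun i => exponent f (u i)

end

/-- The lattice `L(t)` of all `r ∈ ℤ ^ m` with `0 ≤ r 1 ≤ ⋯ ≤ r m` and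
`0 ≤ t 1 - r 1 ≤ ⋯ ≤ t m - r m`. -/
def admissible {m : ℕ} (t : Fin m → ℤ) : Set (Fin m → ℤ) :=
  {r | (∀ i, 0 ≤ r i) ∧ Monotone r ∧ (∀ i, 0 ≤ t i - r i) ∧ Monotone fun i => t i - r i}

end CharHyper

namespace CharHyper

section

variable {K V : Type*} [Field K] [AddCommGroup V] [Module K V] {f : Module.End K V}

/-! The vectors `f ^ k (u i)`, `k < t i`, form a basis, and the commutant of `f` is spanned by
shifts `u j ↦ f ^ d (u i)` with `t i ≤ t j + d`. A characteristic `X` is stable under every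
nilpotent `g` commuting with `f`, because `1 + g` is an automorphism. So it is stable under
off-diagonal shifts, under `f` times a projection, and under projections to repeated generators.
Only the projections to `u ρ` and `u τ` can fail, and they fail together.

When they fail, let `ℓ i` be least with `f ^ ℓ i (u i) ∈ X` (`level`). Over two elements, `f ^ (ℓ ρ
- 1) (u ρ) + f ^ (ℓ τ - 1) (u τ)` lies in `X` (`level_pos_and_add_mem`), so `X` is the hull for `μ =
ℓ - e_ρ - e_τ` (`eq_charHull`). Off-diagonal shifts give the inequalities.

Conversely, the inequalities force the coefficients of `f ^ μ ρ (u ρ)` and `f ^ μ τ (u τ)` to agree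
on the whole hull, both being `1` on automorphic images of the generator. A projection breaks this
agreement (`not_isHyperinvariant_charHull`). -/

theorem pow_exponent_apply (hf : IsNilpotent f) (x : V) : (f ^ exponent f x) x = 0 := by
  obtain ⟨n, hn⟩ := hf
  exact Nat.sInf_mem (s := {l : ℕ | (f ^ l) x = 0}) ⟨n, by simp [hn]⟩

theorem pow_apply_ne_zero_of_lt_exponent {x : V} {l : ℕ} (h : l < exponent f x) :
    (f ^ l) x ≠ 0 :=
  Nat.notMem_of_lt_sInf (s := {l : ℕ | (f ^ l) x = 0}) h

theorem pow_apply_eq_zero_of_le {x : V} {k l : ℕ} (h : (f ^ k) x = 0) (hkl : k ≤ l) :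
    (f ^ l) x = 0 := by
  obtain ⟨d, rfl⟩ := Nat.exists_eq_add_of_le hkl
  rw [add_comm, pow_add, Module.End.mul_apply, h, map_zero]

/-! ### Coordinates and shifts -/

theorem linearIndependent_pow_apply (hf : IsNilpotent f) (x : V) :
    LinearIndependent K fun k : Fin (exponent f x) => (f ^ (k : ℕ)) x := by
  rw [Fintype.linearIndependent_iff]
  intro g hg k
  induction k using WellFoundedLT.induction with | _ k ih
  -- This power kills the terms above `k`; those below vanish by induction.
  have h := congrArg (f ^ (exponent f x - 1 - k)) hg
  rw [map_sum, map_zero, Finset.sum_eq_single k] at h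
  · rw [map_smul, ← Module.End.mul_apply, ← pow_add] at h
    refine (smul_eq_zero.1 h).resolve_right (pow_apply_ne_zero_of_lt_exponent ?_)
    omega
  · intro j _ hjk
    rcases lt_or_gt_of_ne hjk with hj | hj
    · simp [ih j hj]
    · rw [map_smul, ← Module.End.mul_apply, ← pow_add,
        pow_apply_eq_zero_of_le (pow_exponent_apply hf x), smul_zero]
      have : (k : ℕ) < j := hj
      omega
  · simp

theorem pow_apply_mem_cyclicSpan (f : Module.End K V) (x : V) (k : ℕ) :
    (f ^ k) x ∈ cyclicSpan f x :=
  Submodule.subset_span ⟨k, rfl⟩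

/-- The basis `x, f x, …, f ^ (e - 1) x` of the cyclic subspace of `x`. -/
noncomputable def cyclicBasis (hf : IsNilpotent f) (x : V) :
    Module.Basis (Fin (exponent f x)) K (cyclicSpan f x) :=
  Module.Basis.mk
    (v := fun k => (⟨(f ^ (k : ℕ)) x, pow_apply_mem_cyclicSpan f x k⟩ : cyclicSpan f x))
    (LinearIndependent.of_comp (cyclicSpan f x).subtype (linearIndependent_pow_apply hf x))
    (by
      rw [← Submodule.map_le_map_iff_of_injective (cyclicSpan f x).injective_subtype,
        Submodule.map_span, Submodule.map_subtype_top]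
      refine (Submodule.span_le.2 ?_ : cyclicSpan f x ≤ _)
      rintro _ ⟨k, rfl⟩
      by_cases hk : k < exponent f x
      · exact Submodule.subset_span ⟨_, ⟨⟨k, hk⟩, rfl⟩, rfl⟩
      · simp [pow_apply_eq_zero_of_le (pow_exponent_apply hf x) (not_lt.1 hk)])

/-- `C i k x` is the coefficient of `f ^ k (u i)` in the expansion of `x`, where the
`f ^ k (u i)` with `k < t i` form a basis of `V`. -/
structure IsCoordSystem (f : Module.End K V) {ι : Type*} [Fintype ι] [DecidableEq ι] (u : ι → V)
    (t : ι → ℕ) (C : ι → ℕ → V →ₗ[K] K) : Prop where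
  pow_apply_eq_zero : ∀ i, (f ^ t i) (u i) = 0
  coord_pow_apply : ∀ i j k l,
    C i k ((f ^ l) (u j)) = if i = j ∧ k = l ∧ l < t j then 1 else 0
  sum_coord : ∀ x, ∑ i, ∑ k ∈ Finset.range (t i), C i k x • (f ^ k) (u i) = x

theorem IsGeneratorTuple.exists_isCoordSystem (hf : IsNilpotent f) {m : ℕ} {u : Fin m → V}
    (hu : IsGeneratorTuple f u) :
    ∃ C : Fin m → ℕ → V →ₗ[K] K, IsCoordSystem f u (fun i => exponent f (u i)) C := by
  let b := hu.isInternal.collectedBasis fun i => cyclicBasis hf (u i)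
  have hb : ∀ i (k : Fin (exponent f (u i))), b ⟨i, k⟩ = (f ^ (k : ℕ)) (u i) := by
    intro i k
    simp [b, cyclicBasis]
  refine ⟨fun i k => if h : k < exponent f (u i) then b.coord ⟨i, ⟨k, h⟩⟩ else 0,
    fun i => pow_exponent_apply hf (u i), fun i j k l => ?_, fun x => ?_⟩
  · by_cases hl : l < exponent f (u j)
    · have := hb j ⟨l, hl⟩
      simp only at this
      rw [← this]
      split_ifs with hk h h
      · obtain ⟨rfl, rfl, -⟩ := h
        simp
      · rw [Module.Basis.coord_apply, Module.Basis.repr_self, Finsupp.single_eq_of_ne]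
        rintro h'
        apply h
        rw [Sigma.mk.injEq] at h'
        obtain ⟨rfl, h'⟩ := h'
        simp at h'
        exact ⟨rfl, h', hl⟩
      · obtain ⟨rfl, rfl, -⟩ := h
        exact absurd hl hk
      · rfl
    · rw [pow_apply_eq_zero_of_le (pow_exponent_apply hf _) (not_lt.1 hl), map_zero, if_neg]
      tauto
  · conv_rhs => rw [← b.sum_repr x, Fintype.sum_sigma]
    refine Finset.sum_congr rfl fun i _ => ?_
    rw [Finset.sum_range]
    refine Finset.sum_congr rfl fun k _ => ?_
    simp [hb]

namespace IsCoordSystem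

variable {ι : Type*} [Fintype ι] [DecidableEq ι] {u : ι → V} {t : ι → ℕ}
  {C : ι → ℕ → V →ₗ[K] K}

theorem pow_apply_of_le (h : IsCoordSystem f u t C) {i : ι} {k : ℕ} (hk : t i ≤ k) :
    (f ^ k) (u i) = 0 :=
  pow_apply_eq_zero_of_le (h.pow_apply_eq_zero i) hk

theorem hom_ext (h : IsCoordSystem f u t C) {W : Type*} [AddCommGroup W] [Module K W]
    {g g' : V →ₗ[K] W} (hg : ∀ i k, k < t i → g ((f ^ k) (u i)) = g' ((f ^ k) (u i))) :
    g = g' := by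
  ext x
  rw [← h.sum_coord x, map_sum, map_sum]
  refine Finset.sum_congr rfl fun i _ => ?_
  rw [map_sum, map_sum]
  refine Finset.sum_congr rfl fun k hk => ?_
  rw [map_smul, map_smul, hg i k (Finset.mem_range.1 hk)]

/-- The bound `k < t i` is needed: beyond it the left side is zero, while `C i (k - n) x` may not
be. -/
theorem coord_pow (h : IsCoordSystem f u t C) (i : ι) (k n : ℕ) (x : V) :
    C i k ((f ^ n) x) = if n ≤ k ∧ k < t i then C i (k - n) x else 0 := by
  have : C i k ∘ₗ (f ^ n) = if n ≤ k ∧ k < t i then C i (k - n) else 0 := by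
    refine h.hom_ext fun j l hl => ?_
    rw [LinearMap.comp_apply, ← Module.End.mul_apply, ← pow_add, h.coord_pow_apply]
    by_cases hij : i = j
    · subst hij
      split_ifs with h1 h2 h2
      · rw [h.coord_pow_apply, if_pos ⟨rfl, by omega, hl⟩]
      · omega
      · rw [h.coord_pow_apply, if_neg (by rintro ⟨-, h3, h4⟩; exact h1 ⟨rfl, by omega, by omega⟩)]
      · simp
    · rw [if_neg (by tauto)]
      split_ifs
      · rw [h.coord_pow_apply, if_neg (by tauto)]
      · simp
  have h2 := LinearMap.congr_fun this x
  rw [LinearMap.comp_apply] at h2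
  rw [h2]
  split_ifs <;> simp

theorem coord_of_le (h : IsCoordSystem f u t C) {i : ι} {k : ℕ} (hk : t i ≤ k) (x : V) :
    C i k x = 0 := by
  simpa [not_lt.2 hk] using h.coord_pow i k 0 x

theorem coord_eq_zero_of_pow_eq_zero (h : IsCoordSystem f u t C) {i : ι} {k l : ℕ} {x : V}
    (hx : (f ^ l) x = 0) (hk : k + l < t i) : C i k x = 0 := by
  have := h.coord_pow i (k + l) l x
  rw [hx, map_zero, if_pos ⟨by omega, hk⟩] at this
  simpa using this.symm

/-- The endomorphism that sends `u j` to `f ^ d (u i)` and the other generators to `0`. -/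
def shift (_ : IsCoordSystem f u t C) (i j : ι) (d : ℕ) : Module.End K V :=
  ∑ k ∈ Finset.range (t j), (C j k).smulRight ((f ^ (k + d)) (u i))

theorem shift_apply (h : IsCoordSystem f u t C) (i j : ι) (d : ℕ) (x : V) :
    h.shift i j d x = ∑ k ∈ Finset.range (t j), C j k x • (f ^ (k + d)) (u i) := by
  simp [shift]

/-- `hd` covers `l ≥ t j`, where `f ^ l (u j) = 0` and the image must vanish too; this is what makes
shifts commute with `f`. -/
theorem shift_pow_apply (h : IsCoordSystem f u t C) {i j : ι} {d : ℕ} (hd : t i ≤ t j + d)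
    (n : ι) (l : ℕ) :
    h.shift i j d ((f ^ l) (u n)) = if n = j then (f ^ (l + d)) (u i) else 0 := by
  rw [shift_apply]
  split_ifs with hn
  · subst hn
    by_cases hl : l < t n
    · rw [Finset.sum_eq_single l]
      · simp [h.coord_pow_apply, hl]
      · intro k _ hk
        simp [h.coord_pow_apply, hk]
      · intro h'
        exact absurd (Finset.mem_range.2 hl) h'
    · rw [h.pow_apply_of_le (not_lt.1 hl), h.pow_apply_of_le (by omega)]
      simp
  · refine Finset.sum_eq_zero fun k _ => ?_
    rw [h.coord_pow_apply, if_neg (by tauto), zero_smul]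

theorem commute_shift (h : IsCoordSystem f u t C) {i j : ι} {d : ℕ} (hd : t i ≤ t j + d) :
    Commute (h.shift i j d) f := by
  refine h.hom_ext fun n l _ => ?_
  rw [Module.End.mul_apply, Module.End.mul_apply, ← Module.End.mul_apply f, ← pow_succ',
    h.shift_pow_apply hd, h.shift_pow_apply hd]
  split_ifs
  · rw [← Module.End.mul_apply, ← pow_succ']
    congr 2
    omega
  · simp

theorem shift_mul_shift (h : IsCoordSystem f u t C) {i j k : ι} {d e : ℕ}
    (hd : t i ≤ t j + d) (he : t j ≤ t k + e) :
    h.shift i j d * h.shift j k e = h.shift i k (e + d) := by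
  refine h.hom_ext fun n l _ => ?_
  rw [Module.End.mul_apply, h.shift_pow_apply he, h.shift_pow_apply (by omega)]
  split_ifs
  · rw [h.shift_pow_apply hd, if_pos rfl, add_assoc]
  · simp

theorem isNilpotent_shift_of_ne (h : IsCoordSystem f u t C) {i j : ι} {d : ℕ}
    (hd : t i ≤ t j + d) (hij : i ≠ j) : IsNilpotent (h.shift i j d) := by
  refine ⟨2, h.hom_ext fun n l _ => ?_⟩
  rw [pow_two, Module.End.mul_apply, h.shift_pow_apply hd]
  split_ifs
  · rw [h.shift_pow_apply hd, if_neg hij]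
    simp
  · simp

theorem pow_mul_shift (h : IsCoordSystem f u t C) {i j : ι} {d : ℕ} (hd : t i ≤ t j + d)
    (e : ℕ) : f ^ e * h.shift i j d = h.shift i j (d + e) := by
  refine h.hom_ext fun n l _ => ?_
  rw [Module.End.mul_apply, h.shift_pow_apply hd, h.shift_pow_apply (by omega)]
  split_ifs
  · rw [← Module.End.mul_apply, ← pow_add]
    congr 2
    omega
  · simp

theorem sum_shift_self (h : IsCoordSystem f u t C) (x : V) :
    ∑ i, h.shift i i 0 x = x := by
  conv_rhs => rw [← h.sum_coord x]
  exact Finset.sum_congr rfl fun i _ => by simp [shift_apply]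

theorem coord_shift_self (h : IsCoordSystem f u t C) (i j : ι) (k : ℕ) (x : V) :
    C i k (h.shift j j 0 x) = if i = j then C i k x else 0 := by
  have : C i k ∘ₗ h.shift j j 0 = if i = j then C i k else 0 := by
    refine h.hom_ext fun n l hl => ?_
    rw [LinearMap.comp_apply, h.shift_pow_apply (by omega)]
    split_ifs with h1 h2 h2
    · simp [h1]
    · rw [add_zero, h.coord_pow_apply, if_neg (by tauto)]
      simp
    · rw [h.coord_pow_apply, if_neg (by rintro ⟨rfl, -⟩; exact h1 h2), map_zero]
    · simp
  have h2 := LinearMap.congr_fun this x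
  rw [LinearMap.comp_apply] at h2
  rw [h2]
  split_ifs <;> simp

theorem apply_eq_sum_shift (h : IsCoordSystem f u t C) {g : Module.End K V} (hg : Commute g f)
    (x : V) :
    g x = ∑ j, ∑ i, ∑ l ∈ Finset.range (t i), C i l (g (u j)) • h.shift i j l x := by
  have hgf : ∀ k y, g ((f ^ k) y) = (f ^ k) (g y) := fun k y =>
    LinearMap.congr_fun (hg.pow_right k).eq y
  conv_lhs => rw [← h.sum_coord x, map_sum]
  refine Finset.sum_congr rfl fun j _ => ?_
  rw [map_sum]
  simp_rw [shift_apply, Finset.smul_sum]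
  have : ∀ k, g (C j k x • (f ^ k) (u j)) =
      ∑ i, ∑ l ∈ Finset.range (t i), C i l (g (u j)) • C j k x • (f ^ (k + l)) (u i) := by
    intro k
    rw [map_smul, hgf]
    conv_lhs => rw [← h.sum_coord (g (u j))]
    simp_rw [map_sum, Finset.smul_sum, map_smul, pow_add, Module.End.mul_apply]
    exact Finset.sum_congr rfl fun i _ => Finset.sum_congr rfl fun l _ => smul_comm _ _ _
  simp_rw [this]
  rw [Finset.sum_comm]
  exact Finset.sum_congr rfl fun i _ => Finset.sum_comm

end IsCoordSystem

/-! ### Multiplicities and leading coefficients -/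

namespace IsCoordSystem

variable {ι : Type*} [Fintype ι] [DecidableEq ι] {u : ι → V} {t : ι → ℕ}
  {C : ι → ℕ → V →ₗ[K] K}

theorem ker_inf_range_pow (h : IsCoordSystem f u t C) (r : ℕ) :
    LinearMap.ker f ⊓ LinearMap.range (f ^ r) =
      Submodule.span K (Set.range fun i : {i // r < t i} => (f ^ (t i - 1)) (u i)) := by
  apply le_antisymm
  · rintro x ⟨hx, y, rfl⟩
    have hx1 : (f ^ 1) ((f ^ r) y) = 0 := by simpa using hx
    rw [← h.sum_coord ((f ^ r) y)]
    refine Submodule.sum_mem _ fun i _ => Submodule.sum_mem _ fun k hk => ?_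
    rw [Finset.mem_range] at hk
    by_cases hk1 : k + 1 < t i
    · rw [h.coord_eq_zero_of_pow_eq_zero hx1 hk1, zero_smul]
      exact Submodule.zero_mem _
    by_cases hk2 : r ≤ k
    · refine Submodule.smul_mem _ _ (Submodule.subset_span ⟨⟨i, by omega⟩, ?_⟩)
      simp only
      congr 2
      omega
    · rw [h.coord_pow, if_neg (by tauto), zero_smul]
      exact Submodule.zero_mem _
  · rw [Submodule.span_le]
    rintro _ ⟨⟨i, hi⟩, rfl⟩
    refine ⟨?_, (f ^ (t i - 1 - r)) (u i), ?_⟩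
    · simp only [SetLike.mem_coe, LinearMap.mem_ker]
      rw [← Module.End.mul_apply, ← pow_succ', h.pow_apply_of_le (by omega)]
    · simp only
      rw [← Module.End.mul_apply, ← pow_add]
      congr 2
      omega

theorem finrank_ker_inf_range_pow (h : IsCoordSystem f u t C) (r : ℕ) :
    Module.finrank K ↥(LinearMap.ker f ⊓ LinearMap.range (f ^ r)) =
      (Finset.univ.filter fun i => r < t i).card := by
  rw [h.ker_inf_range_pow, finrank_span_eq_card, Fintype.card_subtype]
  rw [Fintype.linearIndependent_iff]
  intro g hg i
  have := congrArg (C i (t i - 1)) hg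
  rw [map_sum, map_zero, Finset.sum_eq_single i] at this
  · rw [map_smul, h.coord_pow_apply, if_pos ⟨rfl, rfl, by have := i.2; omega⟩] at this
    simpa using this
  · intro j _ hji
    rw [map_smul, h.coord_pow_apply, if_neg, smul_zero]
    rintro ⟨h', -⟩
    exact hji (Subtype.ext h'.symm)
  · simp

/-- The quotient's dimension is the number of `i` with `r - 1 < t i` minus the number with `r < t
i`. -/
theorem elemDivMult_eq_card [FiniteDimensional K V] (h : IsCoordSystem f u t C) {r : ℕ}
    (hr : 0 < r) : elemDivMult f r = (Finset.univ.filter fun i => t i = r).card := by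
  have hle : LinearMap.ker f ⊓ LinearMap.range (f ^ r) ≤
      LinearMap.ker f ⊓ LinearMap.range (f ^ (r - 1)) := by
    refine inf_le_inf_left _ ?_
    rintro _ ⟨y, rfl⟩
    refine ⟨f y, ?_⟩
    rw [← Module.End.mul_apply, ← pow_succ]
    congr 2
    omega
  have h1 := Submodule.finrank_quotient_add_finrank
    ((LinearMap.ker f ⊓ LinearMap.range (f ^ r)).submoduleOf
      (LinearMap.ker f ⊓ LinearMap.range (f ^ (r - 1))))
  rw [(Submodule.submoduleOfEquivOfLe hle).finrank_eq, h.finrank_ker_inf_range_pow,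
    h.finrank_ker_inf_range_pow] at h1
  have h2 : (Finset.univ.filter fun i => r - 1 < t i) =
      (Finset.univ.filter fun i => t i = r) ∪ (Finset.univ.filter fun i => r < t i) := by
    ext i
    simp
    omega
  rw [h2, Finset.card_union_of_disjoint] at h1
  · exact Nat.add_right_cancel h1
  · rw [Finset.disjoint_filter]
    intros
    omega

theorem isUnrepeatedElemDiv_iff [FiniteDimensional K V] (h : IsCoordSystem f u t C) {i : ι}
    (hi : 0 < t i) : IsUnrepeatedElemDiv f (t i) ↔ ∀ j, t j = t i → j = i := by
  rw [IsUnrepeatedElemDiv, h.elemDivMult_eq_card hi, Finset.card_eq_one]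
  constructor
  · rintro ⟨a, ha⟩ j hj
    have h1 : j ∈ ({a} : Finset ι) := ha ▸ by simpa using hj
    have h2 : i ∈ ({a} : Finset ι) := ha ▸ by simp
    rw [Finset.mem_singleton] at h1 h2
    rw [h1, h2]
  · intro hj
    refine ⟨i, ?_⟩
    ext j
    simp only [Finset.mem_filter, Finset.mem_univ, true_and, Finset.mem_singleton]
    exact ⟨hj j, fun h => h ▸ rfl⟩

/-- If `λ ^ t i` is unrepeated, the constant coefficient is multiplicative at `u i`. -/
theorem coord_zero_apply (h : IsCoordSystem f u t C) {i : ι} (hi : ∀ j, t j = t i → j = i)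
    {g : Module.End K V} (hg : Commute g f) {x : V} (hx : (f ^ t i) x = 0) :
    C i 0 (g x) = C i 0 (g (u i)) * C i 0 x := by
  have hgf : ∀ k y, g ((f ^ k) y) = (f ^ k) (g y) := fun k y =>
    LinearMap.congr_fun (hg.pow_right k).eq y
  have hterm : ∀ j, ∀ k, C i 0 (g (C j k x • (f ^ k) (u j))) =
      if j = i ∧ k = 0 then C i 0 (g (u i)) * C i 0 x else 0 := by
    intro j k
    rw [map_smul, map_smul, hgf, h.coord_pow]
    by_cases hk : k = 0
    · subst hk
      by_cases hj : j = i
      · subst hj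
        by_cases h0 : 0 < t j
        · simp [h0, mul_comm]
        · simp [h.coord_of_le (not_lt.1 h0)]
      · rw [if_neg (by tauto : ¬ (j = i ∧ 0 = 0))]
        -- A shorter generator cannot map onto the constant term at `u i`; a longer one has no
        -- constant term in `x`, since `f ^ t i` kills `x`.
        rcases lt_trichotomy (t j) (t i) with hlt | heq | hgt
        · have : (f ^ t j) (g (u j)) = 0 := by
            rw [← hgf, h.pow_apply_eq_zero, map_zero]
          rw [Nat.sub_zero, h.coord_eq_zero_of_pow_eq_zero this (by omega)]
          simp
        · exact absurd (hi j heq) hj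
        · rw [h.coord_eq_zero_of_pow_eq_zero hx (by omega), zero_smul]
    · rw [if_neg (by omega), if_neg (by tauto), smul_zero]
  by_cases h0 : 0 < t i
  · conv_lhs => rw [← h.sum_coord x]
    simp_rw [map_sum, hterm]
    rw [Finset.sum_eq_single i, Finset.sum_eq_single 0]
    · simp
    · intro k _ hk
      simp [hk]
    · intro h'
      simp [h0] at h'
    · intro j _ hj
      simp [hj]
    · simp
  · simp [h.coord_of_le (not_lt.1 h0)]

/-- Under the strict inequalities on exponents, only `u i` contributes to the coefficient of
`f ^ μ i (u i)` in `g z`. -/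
theorem coord_apply_sum_pow (h : IsCoordSystem f u t C) {i : ι} {μ : ι → ℕ}
    (hμ : μ i < t i)
    (hlt : ∀ j, j ≠ i → μ i < μ j ∨ μ i + t j < t i + μ j)
    {g : Module.End K V} (hg : Commute g f) :
    C i (μ i) (g (∑ j, (f ^ μ j) (u j))) = C i 0 (g (u i)) := by
  have hgf : ∀ k y, g ((f ^ k) y) = (f ^ k) (g y) := fun k y =>
    LinearMap.congr_fun (hg.pow_right k).eq y
  rw [map_sum, map_sum, Finset.sum_eq_single i]
  · rw [hgf, h.coord_pow, if_pos ⟨le_rfl, hμ⟩, Nat.sub_self]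
  · intro j _ hj
    rw [hgf, h.coord_pow]
    split_ifs with hle
    · refine h.coord_eq_zero_of_pow_eq_zero (l := t j) ?_ ?_
      · rw [← hgf, h.pow_apply_eq_zero, map_zero]
      · have := hlt j hj
        omega
    · rfl
  · simp

end IsCoordSystem

/-! ### Characteristic subspaces and hulls -/

theorem commute_of_mem_commAut {α : V ≃ₗ[K] V} (hα : α ∈ commAut f) :
    Commute (α : Module.End K V) f :=
  LinearMap.ext hα

theorem symm_mem_commAut {α : V ≃ₗ[K] V} (hα : α ∈ commAut f) : α.symm ∈ commAut f := by
  intro x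
  apply α.injective
  rw [hα]
  simp

theorem trans_mem_commAut {α β : V ≃ₗ[K] V} (hα : α ∈ commAut f) (hβ : β ∈ commAut f) :
    α.trans β ∈ commAut f := fun x => by
  simp [hα x, hβ (α x)]

theorem invSpan_le_iff {B : Set V} {Y : Submodule K V} :
    invSpan f B ≤ Y ↔ ∀ b ∈ B, ∀ k, (f ^ k) b ∈ Y := by
  simp [invSpan, iSup_le_iff, cyclicSpan, Submodule.span_le, Set.range_subset_iff]

theorem pow_apply_mem_charHull {B : Set V} {b : V} (hb : b ∈ B) {α : V ≃ₗ[K] V}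
    (hα : α ∈ commAut f) (k : ℕ) : (f ^ k) (α b) ∈ charHull f B :=
  (invSpan_le_iff (B := {y | ∃ α ∈ commAut f, ∃ b ∈ B, y = α b})).1 le_rfl _
    ⟨α, hα, b, hb, rfl⟩ k

theorem charHull_le_iff {B : Set V} {Y : Submodule K V} :
    charHull f B ≤ Y ↔ ∀ b ∈ B, ∀ α ∈ commAut f, ∀ k, (f ^ k) (α b) ∈ Y := by
  rw [charHull, invSpan_le_iff]
  constructor
  · exact fun h b hb α hα k => h _ ⟨α, hα, b, hb, rfl⟩ k
  · rintro h _ ⟨α, hα, b, hb, rfl⟩ k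
    exact h b hb α hα k

theorem refl_mem_commAut (f : Module.End K V) : LinearEquiv.refl K V ∈ commAut f :=
  fun _ => rfl

theorem mem_charHull {B : Set V} {b : V} (hb : b ∈ B) : b ∈ charHull f B := by
  simpa using pow_apply_mem_charHull hb (refl_mem_commAut f) 0

theorem isCharacteristic_charHull (f : Module.End K V) (B : Set V) :
    IsCharacteristic f (charHull f B) := by
  constructor
  · intro x hx
    have : charHull f B ≤ (charHull f B).comap f := by
      rw [charHull_le_iff]
      intro b hb α hα k
      rw [Submodule.mem_comap, ← Module.End.mul_apply, ← pow_succ']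
      exact pow_apply_mem_charHull hb hα _
    exact this hx
  · intro β hβ x hx
    have : charHull f B ≤ (charHull f B).comap (β : Module.End K V) := by
      rw [charHull_le_iff]
      intro b hb α hα k
      have := LinearMap.congr_fun ((commute_of_mem_commAut hβ).pow_right k).eq (α b)
      rw [Module.End.mul_apply, Module.End.mul_apply] at this
      rw [Submodule.mem_comap, this]
      exact pow_apply_mem_charHull hb (trans_mem_commAut hα hβ) k
    exact this hx

theorem IsCharacteristic.pow_apply_mem {X : Submodule K V} (hX : IsCharacteristic f X) {x : V}
    (hx : x ∈ X) (k : ℕ) : (f ^ k) x ∈ X := by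
  induction k with
  | zero => simpa
  | succ k ih =>
    rw [pow_succ', Module.End.mul_apply]
    exact hX.1 _ ih

theorem IsCharacteristic.charHull_le {X : Submodule K V} (hX : IsCharacteristic f X) {B : Set V}
    (hB : B ⊆ X) : charHull f B ≤ X :=
  charHull_le_iff.2 fun b hb α hα k => hX.pow_apply_mem (hX.2 α hα b (hB hb)) k

/-- `1 + g` is an automorphism, and `g x = (1 + g) x - x`. -/
theorem IsCharacteristic.apply_mem_of_isNilpotent {X : Submodule K V}
    (hX : IsCharacteristic f X) {g : Module.End K V} (hg : Commute g f) (hn : IsNilpotent g)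
    {x : V} (hx : x ∈ X) : g x ∈ X := by
  obtain ⟨v, hv⟩ := hn.isUnit_one_add
  have h1 : ∀ y, LinearMap.GeneralLinearGroup.generalLinearEquiv K V v y = y + g y := by
    intro y
    change (v : Module.End K V) y = _
    rw [hv]
    simp
  have h2 : LinearMap.GeneralLinearGroup.generalLinearEquiv K V v ∈ commAut f := by
    intro y
    rw [h1, h1, map_add]
    exact congrArg _ (LinearMap.congr_fun hg.eq y)
  have h3 := X.sub_mem (hX.2 _ h2 x hx) hx
  rwa [h1, add_sub_cancel_left] at h3

theorem IsCharacteristic.pow_mem_of_sum_mem {X : Submodule K V} (hX : IsCharacteristic f X)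
    {w : V} {t : ℕ} (hw : (f ^ t) w = 0) {c : ℕ → K}
    (hc : ∑ k ∈ Finset.range t, c k • (f ^ k) w ∈ X) {k : ℕ} (hk : c k ≠ 0) :
    (f ^ k) w ∈ X := by
  classical
  let k₀ := Nat.find (⟨k, hk⟩ : ∃ k, c k ≠ 0)
  have hk₀ : c k₀ ≠ 0 := Nat.find_spec (⟨k, hk⟩ : ∃ k, c k ≠ 0)
  have hmin : ∀ l < k₀, c l = 0 := fun l hl => by
    simpa using Nat.find_min (⟨k, hk⟩ : ∃ k, c k ≠ 0) hl
  -- Downward induction on `n`: `f ^ (n - k₀)` turns the sum into `c k₀ • f ^ n w` plus higher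
  -- powers already in `X`.
  have key : ∀ d n, t ≤ n + d → k₀ ≤ n → (f ^ n) w ∈ X := by
    intro d
    induction d with
    | zero =>
      intro n hn _
      rw [pow_apply_eq_zero_of_le hw (by omega)]
      exact X.zero_mem
    | succ d ih =>
      intro n hn hkn
      by_cases hnt : t ≤ n
      · rw [pow_apply_eq_zero_of_le hw hnt]
        exact X.zero_mem
      have h1 := hX.pow_apply_mem hc (n - k₀)
      rw [map_sum, ← Finset.add_sum_erase _ _ (Finset.mem_range.2 (by omega : k₀ < t))] at h1
      have h2 : ∑ l ∈ (Finset.range t).erase k₀, (f ^ (n - k₀)) (c l • (f ^ l) w) ∈ X := by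
        refine X.sum_mem fun l hl => ?_
        rcases lt_trichotomy l k₀ with hl' | hl' | hl'
        · rw [hmin l hl', zero_smul, map_zero]
          exact X.zero_mem
        · exact absurd hl' (Finset.ne_of_mem_erase hl)
        · rw [map_smul, ← Module.End.mul_apply, ← pow_add]
          exact X.smul_mem _ (ih _ (by omega) (by omega))
      have h3 := (X.add_mem_iff_left h2).1 h1
      rw [map_smul, ← Module.End.mul_apply, ← pow_add, Nat.sub_add_cancel hkn] at h3
      exact (X.smul_mem_iff hk₀).1 h3
  exact key t k (by omega) (Nat.find_min' _ hk)

theorem eq_one_of_card_eq_two (hK : Nat.card K = 2) {c : K} (hc : c ≠ 0) : c = 1 := by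
  have : Finite K := Nat.finite_of_card_ne_zero (by omega)
  by_contra h1
  have h2 : ({0, 1, c} : Set K).ncard = 3 :=
    Set.ncard_eq_three.2 ⟨0, 1, c, zero_ne_one, hc.symm, Ne.symm h1, rfl⟩
  have h3 := Set.ncard_le_card ({0, 1, c} : Set K)
  omega

/-! ### Hulls that are not hyperinvariant -/

namespace IsCoordSystem

variable {ι : Type*} [Fintype ι] [DecidableEq ι] {u : ι → V} {t : ι → ℕ}
  {C : ι → ℕ → V →ₗ[K] K} {X : Submodule K V}

/-- The constant coefficient at an unrepeated generator is multiplicative, so for an automorphism it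
is nonzero, hence `1`. -/
theorem coord_zero_commAut (h : IsCoordSystem f u t C) (hK : Nat.card K = 2) {i : ι}
    (hi : ∀ j, t j = t i → j = i) (hpos : 0 < t i) {α : V ≃ₗ[K] V} (hα : α ∈ commAut f) :
    C i 0 (α (u i)) = 1 := by
  refine eq_one_of_card_eq_two hK fun h0 => ?_
  have hx : (f ^ t i) (α.symm (u i)) = 0 := by
    have := LinearMap.congr_fun
      ((commute_of_mem_commAut (symm_mem_commAut hα)).pow_right (t i)).eq (u i)
    rw [Module.End.mul_apply, Module.End.mul_apply, h.pow_apply_eq_zero, map_zero] at this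
    exact this.symm
  have h1 := h.coord_zero_apply hi (commute_of_mem_commAut hα) hx
  have h2 := h.coord_pow_apply i i 0 0
  simp [h0, hpos] at h1 h2
  rw [h1] at h2
  exact zero_ne_one h2

theorem not_isHyperinvariant_charHull (h : IsCoordSystem f u t C) (hK : Nat.card K = 2)
    {ρ τ : ι} (hρτ : ρ ≠ τ) (hρ : ∀ j, t j = t ρ → j = ρ) (hτ : ∀ j, t j = t τ → j = τ)
    {μ : ι → ℕ} (hμρ : μ ρ < t ρ) (hμτ : μ τ < t τ)
    (hltρ : ∀ j, j ≠ ρ → μ ρ < μ j ∨ μ ρ + t j < t ρ + μ j)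
    (hltτ : ∀ j, j ≠ τ → μ τ < μ j ∨ μ τ + t j < t τ + μ j) :
    ¬ IsHyperinvariant f (charHull f {∑ i, (f ^ μ i) (u i)}) := by
  intro hX
  have hker : charHull f {∑ i, (f ^ μ i) (u i)} ≤
      LinearMap.ker (C ρ (μ ρ) - C τ (μ τ)) := by
    rw [charHull_le_iff]
    rintro b rfl α hα k
    have hg : Commute (f ^ k * (α : Module.End K V)) f :=
      ((Commute.refl f).pow_left k).mul_left (commute_of_mem_commAut hα)
    have h1 := h.coord_apply_sum_pow hμρ hltρ hg
    have h2 := h.coord_apply_sum_pow hμτ hltτ hg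
    rw [Module.End.mul_apply, Module.End.mul_apply, LinearEquiv.coe_coe, h.coord_pow _ 0] at h1 h2
    rw [LinearMap.mem_ker, LinearMap.sub_apply, h1, h2]
    by_cases hk : k = 0
    · subst hk
      rw [if_pos ⟨le_rfl, by omega⟩, if_pos ⟨le_rfl, by omega⟩,
        h.coord_zero_commAut hK hρ (by omega) hα, h.coord_zero_commAut hK hτ (by omega) hα,
        sub_self]
    · rw [if_neg (by omega), if_neg (by omega), sub_self]
  -- The projection to `u ρ` keeps the first coefficient, `1`, and erases the second.
  have h1 := hker (hX (h.shift ρ ρ 0) (h.commute_shift (by omega)) _ (mem_charHull rfl))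
  rw [LinearMap.mem_ker, LinearMap.sub_apply, h.coord_shift_self, h.coord_shift_self, if_pos rfl,
    if_neg hρτ.symm, sub_zero, map_sum, Finset.sum_eq_single ρ] at h1
  · rw [h.coord_pow_apply, if_pos ⟨rfl, rfl, hμρ⟩] at h1
    exact one_ne_zero h1
  · intro j _ hj
    rw [h.coord_pow_apply, if_neg (by tauto)]
  · simp

/-! ### Shifts preserving a characteristic subspace -/

theorem shift_mem_of_ne (h : IsCoordSystem f u t C) (hX : IsCharacteristic f X) {i j : ι}
    (hij : i ≠ j) {d : ℕ} (hd : t i ≤ t j + d) {x : V} (hx : x ∈ X) : h.shift i j d x ∈ X :=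
  hX.apply_mem_of_isNilpotent (h.commute_shift hd) (h.isNilpotent_shift_of_ne hd hij) hx

/-- The projection factors through another generator of equal exponent as two off-diagonal shifts.
-/
theorem shift_self_mem_of_repeated (h : IsCoordSystem f u t C) (hX : IsCharacteristic f X)
    {i j : ι} (hij : i ≠ j) (htij : t i = t j) {x : V} (hx : x ∈ X) : h.shift i i 0 x ∈ X := by
  rw [← h.shift_mul_shift (j := j) (d := 0) (e := 0) (by omega) (by omega), Module.End.mul_apply]
  exact h.shift_mem_of_ne hX hij (by omega) (h.shift_mem_of_ne hX hij.symm (by omega) hx)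

theorem apply_shift_self_mem (h : IsCoordSystem f u t C) (hX : IsCharacteristic f X) (i : ι)
    {x : V} (hx : x ∈ X) : f (h.shift i i 0 x) ∈ X := by
  have hc := h.commute_shift (i := i) (j := i) (d := 0) (by omega)
  have hf : IsNilpotent f := by
    refine ⟨∑ i, t i, h.hom_ext fun j l _ => ?_⟩
    rw [← Module.End.mul_apply, ← pow_add, h.pow_apply_of_le, LinearMap.zero_apply]
    exact (Finset.single_le_sum (f := t) (fun _ _ => Nat.zero_le _) (Finset.mem_univ j)).trans
      (Nat.le_add_right _ _)
  exact hX.apply_mem_of_isNilpotent (g := f * h.shift i i 0)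
    ((Commute.refl f).mul_left hc) (hc.symm.isNilpotent_mul_right hf) hx

theorem isHyperinvariant_of_shift_self_mem (h : IsCoordSystem f u t C)
    (hX : IsCharacteristic f X) (hs : ∀ i, ∀ x ∈ X, h.shift i i 0 x ∈ X) :
    IsHyperinvariant f X := by
  intro g hg x hx
  rw [h.apply_eq_sum_shift hg]
  refine X.sum_mem fun j _ => X.sum_mem fun i _ => X.sum_mem fun l _ => ?_
  by_cases hc : C i l (g (u j)) = 0
  · rw [hc, zero_smul]
    exact X.zero_mem
  refine X.smul_mem _ ?_
  by_cases hij : i = j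
  · subst hij
    have := h.pow_mul_shift (i := i) (j := i) (d := 0) (by omega) l
    rw [zero_add] at this
    rw [← this, Module.End.mul_apply]
    exact hX.pow_apply_mem (hs i x hx) l
  · refine h.shift_mem_of_ne hX hij ?_ hx
    -- Shifts violating the exponent bound have coefficient zero in `g`.
    by_contra hlt
    refine hc (h.coord_eq_zero_of_pow_eq_zero (l := t j) ?_ (by omega))
    have := LinearMap.congr_fun (hg.pow_right (t j)).eq (u j)
    rw [Module.End.mul_apply, Module.End.mul_apply, h.pow_apply_eq_zero, map_zero] at this
    exact this.symm

/-! ### Levels -/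

theorem exists_pow_mem (h : IsCoordSystem f u t C) (X : Submodule K V) (i : ι) :
    ∃ k, (f ^ k) (u i) ∈ X :=
  ⟨t i, by rw [h.pow_apply_eq_zero]; exact X.zero_mem⟩

open Classical in
/-- The least `k` with `f ^ k (u i) ∈ X`. -/
noncomputable def level (h : IsCoordSystem f u t C) (X : Submodule K V) (i : ι) : ℕ :=
  Nat.find (h.exists_pow_mem X i)

theorem pow_level_mem (h : IsCoordSystem f u t C) (X : Submodule K V) (i : ι) :
    (f ^ h.level X i) (u i) ∈ X := by
  classical
  exact Nat.find_spec (h.exists_pow_mem X i)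

theorem level_le (h : IsCoordSystem f u t C) {i : ι} {k : ℕ}
    (hk : (f ^ k) (u i) ∈ X) : h.level X i ≤ k := by
  classical
  exact Nat.find_min' (h.exists_pow_mem X i) hk

theorem level_le_self (h : IsCoordSystem f u t C) (X : Submodule K V) (i : ι) :
    h.level X i ≤ t i :=
  h.level_le (by rw [h.pow_apply_eq_zero]; exact X.zero_mem)

theorem pow_mem_of_level_le (h : IsCoordSystem f u t C) (hX : IsCharacteristic f X) {i : ι}
    {k : ℕ} (hk : h.level X i ≤ k) : (f ^ k) (u i) ∈ X := by
  have := hX.pow_apply_mem (h.pow_level_mem X i) (k - h.level X i)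
  rwa [← Module.End.mul_apply, ← pow_add, Nat.sub_add_cancel hk] at this

/-- The source of both monotonicity conditions in `admissible`: take `d = 0`, or `d` the difference
of the exponents. -/
theorem level_le_level_add (h : IsCoordSystem f u t C) (hX : IsCharacteristic f X) {i j : ι}
    {d : ℕ} (hd : t i ≤ t j + d) : h.level X i ≤ h.level X j + d := by
  by_cases hij : i = j
  · subst hij
    omega
  · refine h.level_le ?_
    have := h.shift_mem_of_ne hX hij hd (h.pow_level_mem X j)
    rwa [h.shift_pow_apply hd, if_pos rfl] at this

theorem level_le_of_shift_mem (h : IsCoordSystem f u t C) (hX : IsCharacteristic f X) {i : ι}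
    {x : V} (hx : h.shift i i 0 x ∈ X) {k : ℕ} (hk : C i k x ≠ 0) : h.level X i ≤ k := by
  rw [h.shift_apply] at hx
  exact h.level_le (hX.pow_mem_of_sum_mem (h.pow_apply_eq_zero i) hx hk)

/-- `f` times the projection preserves `X`, so a component of `x` misses `X` by at most one power of
`f`. -/
theorem level_le_succ (h : IsCoordSystem f u t C) (hX : IsCharacteristic f X) {i : ι}
    {x : V} (hx : x ∈ X) {k : ℕ} (hk : C i k x ≠ 0) : h.level X i ≤ k + 1 := by
  have h1 := h.apply_shift_self_mem hX i hx
  rw [h.shift_apply, map_sum] at h1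
  refine h.level_le ?_
  have h2 := hX.pow_mem_of_sum_mem (w := f (u i)) (t := t i) (c := fun k => C i k x) (k := k)
    ?_ ?_ hk
  · rwa [← Module.End.mul_apply, ← pow_succ] at h2
  · rw [← Module.End.mul_apply, ← pow_succ, h.pow_apply_of_le (Nat.le_succ _)]
  · convert h1 using 2 with k
    rw [map_smul, add_zero, ← Module.End.mul_apply, ← Module.End.mul_apply, ← pow_succ, pow_succ']

/-- `Y` is kept apart from `X` so that this also applies to a hull being compared with `X`. -/
theorem shift_self_mem_of_level_le (h : IsCoordSystem f u t C) {Y : Submodule K V}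
    (hY : ∀ k, h.level X i ≤ k → (f ^ k) (u i) ∈ Y) {x : V}
    (hx : ∀ k, C i k x ≠ 0 → h.level X i ≤ k) : h.shift i i 0 x ∈ Y := by
  rw [h.shift_apply]
  refine Y.sum_mem fun k _ => ?_
  by_cases hk : C i k x = 0
  · rw [hk, zero_smul]
    exact Y.zero_mem
  · exact Y.smul_mem _ (hY _ (hx k hk))

end IsCoordSystem

/-! ### Recovering `X` from its levels -/

theorem sum_mem_iff_add_mem {ι : Type*} [Fintype ι] [DecidableEq ι] {Y : Submodule K V}
    {F : ι → V} {ρ τ : ι} (hρτ : ρ ≠ τ) (hF : ∀ i, i ≠ ρ → i ≠ τ → F i ∈ Y) :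
    ∑ i, F i ∈ Y ↔ F ρ + F τ ∈ Y := by
  rw [← Finset.sum_add_sum_compl {ρ, τ} F, Finset.sum_pair hρτ]
  refine Y.add_mem_iff_left (Y.sum_mem fun i hi => ?_)
  simp only [Finset.mem_compl, Finset.mem_insert, Finset.mem_singleton, not_or] at hi
  exact hF i hi.1 hi.2

namespace IsCoordSystem

variable {ι : Type*} [Fintype ι] [DecidableEq ι] {u : ι → V} {t : ι → ℕ}
  {C : ι → ℕ → V →ₗ[K] K} {X : Submodule K V}

theorem shift_self_sub_mem (h : IsCoordSystem f u t C) (hX : IsCharacteristic f X) {i : ι}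
    (hi : 0 < h.level X i) {x : V} (hx : x ∈ X) :
    h.shift i i 0 x - C i (h.level X i - 1) x • (f ^ (h.level X i - 1)) (u i) ∈ X := by
  have hlt := h.level_le_self X i
  have key : h.shift i i 0
      (x - C i (h.level X i - 1) x • (f ^ (h.level X i - 1)) (u i)) ∈ X := by
    refine h.shift_self_mem_of_level_le (fun k hk => h.pow_mem_of_level_le hX hk) fun k hk => ?_
    rw [map_sub, map_smul, h.coord_pow_apply] at hk
    by_cases hk' : k = h.level X i - 1
    · rw [if_pos ⟨rfl, hk', by omega⟩, hk'] at hk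
      simp at hk
    · rw [if_neg (by tauto), smul_zero, sub_zero] at hk
      have := h.level_le_succ hX hx hk
      omega
  rwa [map_sub, map_smul, h.shift_pow_apply (by omega), if_pos rfl, add_zero] at key

/-- The part of `x` outside `X` in the direction `u i` is carried by one coefficient, equal to
`1` over the field with two elements. -/
theorem shift_self_sub_pow_mem (h : IsCoordSystem f u t C) (hK : Nat.card K = 2)
    (hX : IsCharacteristic f X) {i : ι} {x : V} (hx : x ∈ X) (hxi : h.shift i i 0 x ∉ X) :
    0 < h.level X i ∧ h.shift i i 0 x - (f ^ (h.level X i - 1)) (u i) ∈ X := by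
  have hpos : 0 < h.level X i := by
    by_contra h0
    exact hxi (h.shift_self_mem_of_level_le (fun k hk => h.pow_mem_of_level_le hX hk)
      fun k _ => by omega)
  have h1 := h.shift_self_sub_mem hX hpos hx
  have hc : C i (h.level X i - 1) x = 1 := by
    refine eq_one_of_card_eq_two hK fun h0 => hxi ?_
    simpa [h0] using h1
  rw [hc, one_smul] at h1
  exact ⟨hpos, h1⟩

/-- The projections sum to the identity, and the components at the other generators lie in `X`. -/
theorem shift_self_mem_iff (h : IsCoordSystem f u t C) (hX : IsCharacteristic f X) {ρ τ : ι}
    (hρτ : ρ ≠ τ) (hrep : ∀ i, i ≠ ρ → i ≠ τ → ∃ j, i ≠ j ∧ t i = t j) {x : V} (hx : x ∈ X) :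
    h.shift ρ ρ 0 x ∈ X ↔ h.shift τ τ 0 x ∈ X := by
  have h1 := (sum_mem_iff_add_mem (Y := X) (F := fun i => h.shift i i 0 x) hρτ ?_).1
    (by rwa [h.sum_shift_self])
  · exact ⟨fun h2 => (X.add_mem_iff_right h2).1 h1, fun h2 => (X.add_mem_iff_left h2).1 h1⟩
  · intro i hiρ hiτ
    obtain ⟨j, hij, ht⟩ := hrep i hiρ hiτ
    exact h.shift_self_mem_of_repeated hX hij ht hx

theorem level_pos_and_add_mem (h : IsCoordSystem f u t C) (hK : Nat.card K = 2)
    (hX : IsCharacteristic f X) (hnX : ¬ IsHyperinvariant f X) {ρ τ : ι}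
    (hρτ : ρ ≠ τ) (hrep : ∀ i, i ≠ ρ → i ≠ τ → ∃ j, i ≠ j ∧ t i = t j) :
    0 < h.level X ρ ∧ 0 < h.level X τ ∧
      (f ^ (h.level X ρ - 1)) (u ρ) + (f ^ (h.level X τ - 1)) (u τ) ∈ X := by
  have hex : ∃ x ∈ X, h.shift ρ ρ 0 x ∉ X := by
    by_contra! hall
    refine hnX (h.isHyperinvariant_of_shift_self_mem hX fun i x hx => ?_)
    by_cases hiρ : i = ρ
    · exact hiρ ▸ hall x hx
    by_cases hiτ : i = τ
    · exact hiτ ▸ (h.shift_self_mem_iff hX hρτ hrep hx).1 (hall x hx)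
    obtain ⟨j, hij, ht⟩ := hrep i hiρ hiτ
    exact h.shift_self_mem_of_repeated hX hij ht hx
  obtain ⟨x, hx, hxρ⟩ := hex
  have hxτ : h.shift τ τ 0 x ∉ X := fun h' => hxρ ((h.shift_self_mem_iff hX hρτ hrep hx).2 h')
  obtain ⟨hρ0, hρ1⟩ := h.shift_self_sub_pow_mem hK hX hx hxρ
  obtain ⟨hτ0, hτ1⟩ := h.shift_self_sub_pow_mem hK hX hx hxτ
  refine ⟨hρ0, hτ0, ?_⟩
  have h1 := (sum_mem_iff_add_mem (Y := X) (F := fun i => h.shift i i 0 x) hρτ ?_).1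
    (by rwa [h.sum_shift_self])
  · convert X.sub_mem h1 (X.add_mem hρ1 hτ1) using 1
    abel
  · intro i hiρ hiτ
    obtain ⟨j, hij, ht⟩ := hrep i hiρ hiτ
    exact h.shift_self_mem_of_repeated hX hij ht hx

/-- A characteristic subspace that is not hyperinvariant is the characteristic hull of one
vector. -/
theorem eq_charHull (h : IsCoordSystem f u t C) (hX : IsCharacteristic f X) {ρ τ : ι}
    (hρτ : ρ ≠ τ) (hrep : ∀ i, i ≠ ρ → i ≠ τ → ∃ j, i ≠ j ∧ t i = t j)
    (hρ0 : 0 < h.level X ρ) (hτ0 : 0 < h.level X τ)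
    (hadd : (f ^ (h.level X ρ - 1)) (u ρ) + (f ^ (h.level X τ - 1)) (u τ) ∈ X)
    {μ : ι → ℕ} (hμ : ∀ i, i ≠ ρ → i ≠ τ → μ i = h.level X i)
    (hμρ : μ ρ = h.level X ρ - 1) (hμτ : μ τ = h.level X τ - 1) :
    X = charHull f {∑ i, (f ^ μ i) (u i)} := by
  apply le_antisymm
  · set H := charHull f {∑ i, (f ^ μ i) (u i)} with hH
    have hHc : IsCharacteristic f H := isCharacteristic_charHull _ _
    have hz : ∑ i, (f ^ μ i) (u i) ∈ H := mem_charHull rfl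
    have hcomp : ∀ i, h.shift i i 0 (∑ j, (f ^ μ j) (u j)) = (f ^ μ i) (u i) := by
      intro i
      rw [map_sum, Finset.sum_eq_single i]
      · rw [h.shift_pow_apply (by omega), if_pos rfl, add_zero]
      · intro j _ hj
        rw [h.shift_pow_apply (by omega), if_neg hj]
      · simp
    have hHi : ∀ i, i ≠ ρ → i ≠ τ → (f ^ μ i) (u i) ∈ H := by
      intro i hiρ hiτ
      obtain ⟨j, hij, ht⟩ := hrep i hiρ hiτ
      rw [← hcomp i]
      exact h.shift_self_mem_of_repeated hHc hij ht hz
    have hHf : ∀ i, (f ^ (μ i + 1)) (u i) ∈ H := by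
      intro i
      rw [pow_succ', Module.End.mul_apply, ← hcomp i]
      exact h.apply_shift_self_mem hHc i hz
    -- The hull contains every `f ^ k (u i)` that lies in `X`.
    have hHlev : ∀ i k, h.level X i ≤ k → (f ^ k) (u i) ∈ H := by
      intro i k hk
      have hlev : (f ^ h.level X i) (u i) ∈ H := by
        by_cases hiρ : i = ρ
        · subst hiρ
          have := hHf i
          rwa [hμρ, Nat.sub_add_cancel hρ0] at this
        by_cases hiτ : i = τ
        · subst hiτ
          have := hHf i
          rwa [hμτ, Nat.sub_add_cancel hτ0] at this
        rw [← hμ i hiρ hiτ]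
        exact hHi i hiρ hiτ
      have := hHc.pow_apply_mem hlev (k - h.level X i)
      rwa [← Module.End.mul_apply, ← pow_add, Nat.sub_add_cancel hk] at this
    have hHadd := (sum_mem_iff_add_mem hρτ hHi).1 hz
    rw [hμρ, hμτ] at hHadd
    intro x hx
    -- Subtracting `c` times the mixed vector removes the only coefficient at `ρ` that can lie
    -- outside `X`; all components of `y` are then in `X`.
    set c := C ρ (h.level X ρ - 1) x with hc
    set y := x - c • ((f ^ (h.level X ρ - 1)) (u ρ) + (f ^ (h.level X τ - 1)) (u τ)) with hy
    have hyX : y ∈ X := X.sub_mem hx (X.smul_mem _ hadd)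
    have hyρ : h.shift ρ ρ 0 y ∈ X := by
      have h1 := h.shift_self_sub_mem hX hρ0 hyX
      have h2 : C ρ (h.level X ρ - 1) y = 0 := by
        have := h.level_le_self X ρ
        rw [hy, map_sub, map_smul, map_add, h.coord_pow_apply, h.coord_pow_apply,
          if_pos ⟨rfl, rfl, by omega⟩, if_neg (by tauto), ← hc]
        simp
      rwa [h2, zero_smul, sub_zero] at h1
    have hyi : ∀ i, h.shift i i 0 y ∈ X := by
      intro i
      by_cases hiρ : i = ρ
      · exact hiρ ▸ hyρ
      by_cases hiτ : i = τ
      · exact hiτ ▸ (h.shift_self_mem_iff hX hρτ hrep hyX).1 hyρ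
      obtain ⟨j, hij, ht⟩ := hrep i hiρ hiτ
      exact h.shift_self_mem_of_repeated hX hij ht hyX
    have hyH : y ∈ H := by
      rw [← h.sum_shift_self y]
      exact H.sum_mem fun i _ => h.shift_self_mem_of_level_le (hHlev i) fun k hk =>
        h.level_le_of_shift_mem hX (hyi i) hk
    have : x = y + c • ((f ^ (h.level X ρ - 1)) (u ρ) + (f ^ (h.level X τ - 1)) (u τ)) := by
      rw [hy, sub_add_cancel]
    rw [this]
    exact H.add_mem hyH (H.smul_mem _ hHadd)
  · refine hX.charHull_le ?_
    rw [Set.singleton_subset_iff]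
    refine (sum_mem_iff_add_mem hρτ fun i hiρ hiτ => ?_).2 (by rwa [hμρ, hμτ])
    rw [hμ i hiρ hiτ]
    exact h.pow_level_mem X i

/-- The shifts between `u ρ` and `u τ` each isolate one summand of the mixed vector; its exponent
`level - 1` makes the inequalities strict. -/
theorem level_lt_level (h : IsCoordSystem f u t C) (hX : IsCharacteristic f X) {ρ τ : ι}
    (hρτ : t ρ < t τ) (hρ0 : 0 < h.level X ρ) (hτ0 : 0 < h.level X τ)
    (hadd : (f ^ (h.level X ρ - 1)) (u ρ) + (f ^ (h.level X τ - 1)) (u τ) ∈ X) :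
    h.level X ρ < h.level X τ ∧ h.level X τ + t ρ < h.level X ρ + t τ := by
  have hne : ρ ≠ τ := fun h' => by simp [h'] at hρτ
  constructor
  · have h1 := h.shift_mem_of_ne hX hne (d := 0) (by omega) hadd
    rw [map_add, h.shift_pow_apply (by omega), h.shift_pow_apply (by omega), if_neg hne,
      if_pos rfl, zero_add] at h1
    have := h.level_le h1
    omega
  · have h1 := h.shift_mem_of_ne hX hne.symm (d := t τ - t ρ) (by omega) hadd
    rw [map_add, h.shift_pow_apply (by omega), h.shift_pow_apply (by omega), if_pos rfl,
      if_neg hne.symm, add_zero] at h1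
    have := h.level_le h1
    omega

end IsCoordSystem

end

end CharHyper

theorem mainTheorem2 {K V : Type*} [Field K] [AddCommGroup V] [Module K V]
    [FiniteDimensional K V] (hK : Nat.card K = 2)
    (f : Module.End K V) (hf : IsNilpotent f)
    (R S : ℕ) (hRS : R < S)
    (hunrep : ∀ r : ℕ, CharHyper.IsUnrepeatedElemDiv f r ↔ r = R ∨ r = S)
    {m : ℕ} (u : Fin m → V) (hu : CharHyper.IsGeneratorTuple f u)
    (ρ τ : Fin m) (hρ : CharHyper.exponent f (u ρ) = R) (hτ : CharHyper.exponent f (u τ) = S)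
    (X : Submodule K V) :
    (CharHyper.IsCharacteristic f X ∧ ¬ CharHyper.IsHyperinvariant f X) ↔
      ∃ μ : Fin m → ℕ,
        X = CharHyper.charHull f {∑ i, (f ^ μ i) (u i)} ∧
        (0 ≤ μ ρ ∧ μ ρ < μ τ) ∧
        ((0 : ℤ) < (R : ℤ) - μ ρ ∧ (R : ℤ) - μ ρ < (S : ℤ) - μ τ) ∧
        (fun i => (μ i : ℤ)) + (Pi.single ρ 1 + Pi.single τ 1) ∈
          CharHyper.admissible fun i => (CharHyper.exponent f (u i) : ℤ) := by
  obtain ⟨C, h⟩ := hu.exists_isCoordSystem hf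
  have hmono := hu.monotone_exponent
  have hpos : ∀ i, 0 < CharHyper.exponent f (u i) := by
    intro i
    by_contra h0
    have := CharHyper.pow_exponent_apply hf (u i)
    rw [Nat.eq_zero_of_not_pos h0] at this
    exact hu.ne_zero i (by simpa using this)
  have hunrep' : ∀ i, (∀ j, CharHyper.exponent f (u j) = CharHyper.exponent f (u i) → j = i) ↔
      CharHyper.exponent f (u i) = R ∨ CharHyper.exponent f (u i) = S := fun i => by
    rw [← hunrep, h.isUnrepeatedElemDiv_iff (hpos i)]
  have hρ' := (hunrep' ρ).2 (Or.inl hρ)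
  have hτ' := (hunrep' τ).2 (Or.inr hτ)
  set t : Fin m → ℕ := fun i => CharHyper.exponent f (u i) with ht
  change t ρ = R at hρ
  change t τ = S at hτ
  change ∀ j, t j = t ρ → j = ρ at hρ'
  change ∀ j, t j = t τ → j = τ at hτ'
  have hρτ : ρ ≠ τ := by
    rintro rfl
    omega
  constructor
  · rintro ⟨hX, hnX⟩
    have hrep : ∀ i, i ≠ ρ → i ≠ τ → ∃ j, i ≠ j ∧ t i = t j := by
      intro i hiρ hiτ
      by_contra! hall
      rcases (hunrep' i).1 fun j hj => by_contra fun hji => hall j (Ne.symm hji) hj.symm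
        with h1 | h1
      · exact hiρ (hρ' i (h1.trans hρ.symm))
      · exact hiτ (hτ' i (h1.trans hτ.symm))
    obtain ⟨hρ0, hτ0, hadd⟩ := h.level_pos_and_add_mem hK hX hnX hρτ hrep
    obtain ⟨h1, h2⟩ := h.level_lt_level hX (by omega) hρ0 hτ0 hadd
    have hρt := h.level_le_self X ρ
    -- Chosen so that adding the two unit vectors returns the levels.
    let μ : Fin m → ℕ := fun i => if i = ρ ∨ i = τ then h.level X i - 1 else h.level X i
    have hμρ : μ ρ = h.level X ρ - 1 := by simp [μ]
    have hμτ : μ τ = h.level X τ - 1 := by simp [μ]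
    have hμ : ∀ i, i ≠ ρ → i ≠ τ → μ i = h.level X i := fun i hiρ hiτ => by simp [μ, hiρ, hiτ]
    have hr : (fun i => (μ i : ℤ)) + (Pi.single ρ 1 + Pi.single τ 1) =
        fun i => (h.level X i : ℤ) := by
      funext i
      by_cases hiρ : i = ρ
      · subst hiρ
        simp [hμρ, hρτ]
        omega
      by_cases hiτ : i = τ
      · subst hiτ
        simp [hμτ, hiρ]
        omega
      simp [hiρ, hiτ, hμ]
    refine ⟨μ, h.eq_charHull hX hρτ hrep hρ0 hτ0 hadd hμ hμρ hμτ, ⟨Nat.zero_le _, by omega⟩,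
      ⟨by omega, by omega⟩, ?_⟩
    rw [hr]
    refine ⟨fun i => Int.natCast_nonneg _, fun i j hij => ?_, fun i => ?_, fun i j hij => ?_⟩
    · have := h.level_le_level_add hX (i := i) (j := j) (d := 0) (by simpa using hmono hij)
      simp only
      omega
    · have := h.level_le_self X i
      change (0 : ℤ) ≤ (t i : ℤ) - h.level X i
      omega
    · have h3 : t i ≤ t j := hmono hij
      have := h.level_le_level_add hX (i := j) (j := i) (d := t j - t i) (by omega)
      change (t i : ℤ) - h.level X i ≤ (t j : ℤ) - h.level X j
      omega
  · rintro ⟨μ, rfl, ⟨-, h1⟩, ⟨h2, h3⟩, -, hr1, -, hr2⟩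
    refine ⟨CharHyper.isCharacteristic_charHull _ _, ?_⟩
    have hlt : ∀ i j, t i < t j → i < j := fun i j hij => by
      by_contra hji
      have : t j ≤ t i := hmono (not_lt.1 hji)
      omega
    -- The unit added at `ρ` but not at `j` turns the weak inequalities of `admissible` into strict
    -- ones.
    have hrρ : ∀ j, j ≠ ρ → j ≠ τ → μ ρ < μ j ∨ μ ρ + t j < t ρ + μ j := by
      intro j hjρ hjτ
      rcases lt_or_gt_of_ne (fun h' => hjρ (hρ' j h') : t j ≠ t ρ) with hj | hj
      · have := hr2 (hlt _ _ hj).le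
        change (t j : ℤ) - _ ≤ (t ρ : ℤ) - _ at this
        simp [hjρ, hjτ, hρτ] at this
        omega
      · have := hr1 (hlt _ _ hj).le
        simp [hjρ, hjτ, hρτ] at this
        omega
    have hrτ : ∀ j, j ≠ ρ → j ≠ τ → μ τ < μ j ∨ μ τ + t j < t τ + μ j := by
      intro j hjρ hjτ
      rcases lt_or_gt_of_ne (fun h' => hjτ (hτ' j h') : t j ≠ t τ) with hj | hj
      · have := hr2 (hlt _ _ hj).le
        change (t j : ℤ) - _ ≤ (t τ : ℤ) - _ at this
        simp [hjρ, hjτ, hρτ.symm] at this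
        omega
      · have := hr1 (hlt _ _ hj).le
        simp [hjρ, hjτ, hρτ.symm] at this
        omega
    refine h.not_isHyperinvariant_charHull hK hρτ hρ' hτ' (by omega) (by omega)
      (fun j hj => ?_) (fun j hj => ?_)
    -- Between `ρ` and `τ` both units cancel, so strictness comes from `h1` and `h3`.
    · by_cases hjτ : j = τ
      · subst hjτ
        omega
      · exact hrρ j hj hjτ
    · by_cases hjρ : j = ρ
      · subst hjρ
        omega
      · exact hrτ j hjρ hj
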